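/- Let $n\ge 0$ and let $\mathcal B$ be a building set on $[n]=\{1,\dots,n\}$, i.e. a collection of nonempty subsets of $[n]$ that contains every singleton $\{i\}$ and satisfies $I\cup J\in\mathcal B$ whenever $I,J\in\mathcal B$ and $I\cap J\neq\varnothing$. An extended nested collection on $\mathcal B$ is a set $\sigma=\{I_1,\dots,I_m,x_{i_1},\dots,x_{i_r}\}$ of elements $I_j\in\mathcal B$ (maximal elements of $\mathcal B$ allowed) and formal symbols $x_i$, $i\in[n]$, such that any two $I_j$ are nested or disjoint, the union of any $k\ge 2$ pairwise disjoint $I_j$'s is not in $\mathcal B$, and $i_k\notin I_j$ for all $k,j$. The extended nested collections (including $\varnothing$) are the faces of a simplicial complex, the extended nested complex $\mathcal N^\square(\mathcal B)$. An extended nestohedron $\mathcal P^\square(\mathcal B)$ is a polytope combinatorially isomorphic (isomorphic face lattice) to the polar dual $\{y : \langle y,x\rangle\le 1 \text{ for all } x\in N\}$ of a simplicial polytope $N\subset\mathbb R^n$ with $0$ in its interior whose boundary complex is isomorphic to $\mathcal N^\square(\mathcal B)$. Let $e_1,\dots,e_n$ be the standard basis of $\mathbb R^n$, let $e_S=\sum_{i\in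 S}e_i$ for $S\subseteq[n]$, and let $$\mathcal P=\sum_{i\in[n]}\operatorname{Conv}(0,e_i)+\sum_{I\in\mathcal B}\operatorname{Conv}\{e_S : S\subsetneq I\}$$ (Minkowski sum). Then $\mathcal P$ is an extended nestohedron $\mathcal P^\square(\mathcal B)$; in particular a simplicial polytope $N$ as above exists. Moreover, for an extended nested collection $\sigma$ let $F_\sigma$ be the set of points of $\mathcal P$ that maximize $\sum_{i\in I}t_i$ over $\mathcal P$ for every $I\in\sigma$ and minimize $t_i$ over $\mathcal P$ for every $x_i\in\sigma$. Then $\sigma\mapsto F_\sigma$ is a bijection from the extended nested collections on $\mathcal B$ onto the nonempty faces of $\mathcal P$ (the sets of maximizers over $\mathcal P$ of linear functionals on $\mathbb R^n$), and $\sigma\subseteq\tau$ if and only if $F_\tau\subseteq F_\sigma$. -/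

import Mathlib

open scoped Pointwise

/-- A building set on `[n]`: a collection of nonempty subsets of `[n]` containing all singletons
and closed under unions of intersecting pairs. -/
structure IsBuildingSet {n : ℕ} (B : Finset (Finset (Fin n))) : Prop where
  nonempty_of_mem : ∀ I ∈ B, I.Nonempty
  singleton_mem : ∀ i : Fin n, {i} ∈ B
  union_mem : ∀ I ∈ B, ∀ J ∈ B, (I ∩ J).Nonempty → I ∪ J ∈ B

/-- The vertices of the extended nested complex are the sets `I ∈ B`, written `Sum.inl I`, and the
design vertices `x_i` for `i ∈ [n]`, written `Sum.inr i`. -/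
abbrev NestedVertex (n : ℕ) : Type := Finset (Fin n) ⊕ Fin n

/-- `σ = {I_1, …, I_m, x_{i_1}, …, x_{i_r}}` is an extended nested collection on `B`. The `I_j` are
arbitrary elements of `B`; the maximal elements of `B` are allowed. -/
structure IsExtendedNested {n : ℕ} (B : Finset (Finset (Fin n)))
    (σ : Finset (NestedVertex n)) : Prop where
  mem : ∀ I, Sum.inl I ∈ σ → I ∈ B
  nested_or_disjoint : ∀ I J, Sum.inl I ∈ σ → Sum.inl J ∈ σ → I ⊆ J ∨ J ⊆ I ∨ Disjoint I J
  biUnion_notMem : ∀ T : Finset (Finset (Fin n)), (∀ I ∈ T, Sum.inl I ∈ σ) → 2 ≤ T.card →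
    (∀ I ∈ T, ∀ J ∈ T, I ≠ J → Disjoint I J) → T.biUnion id ∉ B
  design_notMem : ∀ i I, Sum.inr i ∈ σ → Sum.inl I ∈ σ → i ∉ I

/-- The extended nested complex of `B`, as the set of its faces (the empty face included). -/
def extendedNestedComplex {n : ℕ} (B : Finset (Finset (Fin n))) : Set (Finset (NestedVertex n)) :=
  {σ | IsExtendedNested B σ}

/-- The extended nested complex is closed under passing to subsets. -/
theorem isLowerSet_extendedNestedComplex {n : ℕ} (B : Finset (Finset (Fin n))) :
    IsLowerSet (extendedNestedComplex B) := by
  intro σ τ hτ hσ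
  exact ⟨fun I hI => hσ.mem I (hτ hI),
    fun I J hI hJ => hσ.nested_or_disjoint I J (hτ hI) (hτ hJ),
    fun T hT => hσ.biUnion_notMem T fun I hI => hτ (hT I hI),
    fun i I hi hI => hσ.design_notMem i I (hτ hi) (hτ hI)⟩

/-- A polytope in `ℝⁿ`: the convex hull of a finite set. Its faces are its exposed subsets
(`IsExposed ℝ P F`): the empty face, and the sets of maximizers of linear functionals on `P`,
among them `P` itself. -/
def IsPolytope {n : ℕ} (P : Set (Fin n → ℝ)) : Prop :=
  ∃ s : Finset (Fin n → ℝ), P = convexHull ℝ (s : Set (Fin n → ℝ))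

/-- The proper faces of a polytope (the empty face included). They make up its boundary. -/
def properFaces {n : ℕ} (P : Set (Fin n → ℝ)) : Set (Set (Fin n → ℝ)) :=
  {F | IsExposed ℝ P F ∧ F ≠ P}

/-- A simplicial polytope: every proper face is a simplex. -/
def IsSimplicialPolytope {n : ℕ} (P : Set (Fin n → ℝ)) : Prop :=
  IsPolytope P ∧ ∀ F ∈ properFaces P, ∃ s : Finset (Fin n → ℝ),
    AffineIndependent ℝ ((↑) : s → (Fin n → ℝ)) ∧ F = convexHull ℝ (s : Set (Fin n → ℝ))

/-- The simplicial complex `Δ` is isomorphic to the boundary complex of the simplicial polytope `N`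
by the vertex map `φ`: sending `σ` to the convex hull of `φ(σ)` is an inclusion-preserving and
inclusion-reflecting bijection from the faces of `Δ` onto the proper faces of `N`. -/
def IsBoundaryRealization {V : Type*} {n : ℕ} (Δ : Set (Finset V)) (N : Set (Fin n → ℝ))
    (φ : V → (Fin n → ℝ)) : Prop :=
  IsSimplicialPolytope N ∧
  Set.BijOn (fun σ : Finset V => convexHull ℝ (φ '' (σ : Set V))) Δ (properFaces N) ∧
  ∀ σ ∈ Δ, ∀ τ ∈ Δ,
    (σ ⊆ τ ↔ convexHull ℝ (φ '' (σ : Set V)) ⊆ convexHull ℝ (φ '' (τ : Set V)))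

/-- The polar dual of a polytope (with the origin in its interior). -/
def polarDual {n : ℕ} (P : Set (Fin n → ℝ)) : Set (Fin n → ℝ) :=
  {y | ∀ x ∈ P, y ⬝ᵥ x ≤ 1}

/-- Two polytopes are combinatorially isomorphic: their face lattices are isomorphic. -/
def CombinatoriallyIsomorphic {n m : ℕ} (P : Set (Fin n → ℝ)) (Q : Set (Fin m → ℝ)) : Prop :=
  Nonempty ({F : Set (Fin n → ℝ) // IsExposed ℝ P F} ≃o {F : Set (Fin m → ℝ) // IsExposed ℝ Q F})

/-- `P` is (a realization of) the extended nestohedron of `B`: it is a polytope combinatorially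
isomorphic to the polar dual of a simplicial polytope whose boundary complex is the extended nested
complex of `B`. -/
def IsExtendedNestohedron {n : ℕ} (B : Finset (Finset (Fin n))) (P : Set (Fin n → ℝ)) : Prop :=
  IsPolytope P ∧
  ∃ (N : Set (Fin n → ℝ)) (φ : NestedVertex n → (Fin n → ℝ)),
    IsBoundaryRealization (extendedNestedComplex B) N φ ∧ 0 ∈ interior N ∧
    CombinatoriallyIsomorphic P (polarDual N)

/-- `e_S`, the sum of the standard basis vectors `e_i` with `i ∈ S`. -/
def basisSum {n : ℕ} (S : Finset (Fin n)) : Fin n → ℝ :=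
  ∑ i ∈ S, Pi.single i 1

/-- The Minkowski sum of the segments `Conv(0, e_i)` for `i ∈ [n]` and of the polytopes
`Conv {e_S : S ⊊ I}` for `I ∈ B`. -/
def minkowskiPolytope {n : ℕ} (B : Finset (Finset (Fin n))) : Set (Fin n → ℝ) :=
  (∑ i : Fin n, convexHull ℝ ({0, Pi.single i 1} : Set (Fin n → ℝ))) +
    ∑ I ∈ B, convexHull ℝ {x : Fin n → ℝ | ∃ S : Finset (Fin n), S ⊂ I ∧ x = basisSum S}

/-- The part of `P` labelled by a collection `σ`: the points of `P` that maximize over `P` the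
coordinate sum `∑ i ∈ I, x i` for every `I` in `σ` and minimize `x i` for every `x_i` in `σ`. -/
def labelledFace {n : ℕ} (P : Set (Fin n → ℝ)) (σ : Finset (NestedVertex n)) :
    Set (Fin n → ℝ) :=
  {x | x ∈ P ∧ (∀ I, Sum.inl I ∈ σ → ∀ y ∈ P, ∑ i ∈ I, y i ≤ ∑ i ∈ I, x i) ∧
    ∀ i, Sum.inr i ∈ σ → ∀ y ∈ P, x i ≤ y i}

/-! The normal fan of the Minkowski sum is the simplicial fan whose rays are `e_I` and `-e_i` and
whose cones are spanned by the extended nested collections. This is packaged as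
`IsSimplicialNormalFan`: the cones cover `ℝⁿ`, every `F_σ` is nonempty, and `F_σ` lies in no facet
whose label is outside `σ`.

These properties suffice. A functional that is a positive combination of the normals in `σ` has
maximizer set exactly `F_σ`, so every nonempty face is some `F_σ`; the last property gives
injectivity and reversal of inclusions. Translating an interior point `p` of the polytope to the
origin and scaling each normal by its slack at `p` yields the vertices of the simplicial polytope
`N`, whose polar is the translated polytope (`exists_isPolytopalFan`, `isBoundaryRealization`).

For the Minkowski sum, covering comes from peeling the positive part of a vector into layers
(`exists_nested_decomposition`). The other two properties reduce to choosing an optimal `e_S` in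
each summand separately; `exists_superset` is the combinatorial fact that provides these choices. -/

/-! ### Linear functionals as dot products, and convex hulls. -/

theorem StrongDual.exists_eq_dotProduct {n : ℕ} (l : StrongDual ℝ (Fin n → ℝ)) :
    ∃ w : Fin n → ℝ, ∀ x, l x = w ⬝ᵥ x := by
  refine ⟨fun i => l (Pi.single i 1), fun x => ?_⟩
  conv_lhs => rw [← Finset.univ_sum_single x]
  rw [map_sum]
  refine Finset.sum_congr rfl fun i _ => ?_
  have : (Pi.single i (x i) : Fin n → ℝ) = x i • Pi.single i 1 := by
    rw [← Pi.single_smul, smul_eq_mul, mul_one]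
  rw [this, map_smul, smul_eq_mul, mul_comm]

theorem exists_strongDual_eq_dotProduct {n : ℕ} (w : Fin n → ℝ) :
    ∃ l : StrongDual ℝ (Fin n → ℝ), ∀ x, l x = w ⬝ᵥ x :=
  ⟨LinearMap.toContinuousLinearMap (dotProductBilin ℝ ℝ w), fun _ => rfl⟩

theorem isExposed_iff_dotProduct {n : ℕ} {P F : Set (Fin n → ℝ)} :
    IsExposed ℝ P F ↔
      (F.Nonempty → ∃ w : Fin n → ℝ, F = {x | x ∈ P ∧ ∀ y ∈ P, w ⬝ᵥ y ≤ w ⬝ᵥ x}) := by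
  refine forall_congr' fun _ => ⟨?_, ?_⟩
  · rintro ⟨l, rfl⟩
    obtain ⟨w, hw⟩ := StrongDual.exists_eq_dotProduct l
    exact ⟨w, by simp [hw]⟩
  · rintro ⟨w, rfl⟩
    obtain ⟨l, hl⟩ := exists_strongDual_eq_dotProduct w
    exact ⟨l, by simp [hl]⟩

theorem dotProduct_le_of_mem_convexHull {n : ℕ} {T : Set (Fin n → ℝ)} {w : Fin n → ℝ} {M : ℝ}
    (hT : ∀ t ∈ T, w ⬝ᵥ t ≤ M) {x : Fin n → ℝ} (hx : x ∈ convexHull ℝ T) : w ⬝ᵥ x ≤ M :=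
  convexHull_min (t := {x | w ⬝ᵥ x ≤ M}) hT
    (convex_halfSpace_le (dotProductBilin ℝ ℝ w).isLinear M) hx

theorem dotProduct_eq_of_mem_convexHull {n : ℕ} {T : Set (Fin n → ℝ)} {w : Fin n → ℝ} {M : ℝ}
    (hT : ∀ t ∈ T, w ⬝ᵥ t = M) {x : Fin n → ℝ} (hx : x ∈ convexHull ℝ T) : w ⬝ᵥ x = M :=
  convexHull_min (t := {x | w ⬝ᵥ x = M}) hT
    (convex_hyperplane (dotProductBilin ℝ ℝ w).isLinear M) hx

/-- The points of a convex hull on a supporting hyperplane are spanned by the generators on it. -/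
theorem mem_convexHull_of_dotProduct_eq {n : ℕ} {T : Set (Fin n → ℝ)} {w : Fin n → ℝ} {M : ℝ}
    (hT : ∀ t ∈ T, w ⬝ᵥ t ≤ M) {x : Fin n → ℝ} (hx : x ∈ convexHull ℝ T) (hxM : w ⬝ᵥ x = M) :
    x ∈ convexHull ℝ {t ∈ T | w ⬝ᵥ t = M} := by
  set C := convexHull ℝ {t ∈ T | w ⬝ᵥ t = M}
  have hC : ∀ y ∈ C, w ⬝ᵥ y = M := fun y hy =>
    dotProduct_eq_of_mem_convexHull (fun t ht => ht.2) hy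
  -- The open half-space together with `C` is convex and contains every generator, hence the whole
  -- hull.
  have key : Convex ℝ {y | w ⬝ᵥ y < M ∨ y ∈ C} := by
    intro y hy z hz a b ha hb hab
    rcases ha.eq_or_lt with rfl | ha
    · simp_all
    rcases hb.eq_or_lt with rfl | hb
    · simp_all
    have hle : ∀ u, (w ⬝ᵥ u < M ∨ u ∈ C) → w ⬝ᵥ u ≤ M := fun u hu =>
      hu.elim le_of_lt fun h => (hC u h).le
    have hM : M = a * M + b * M := by rw [← add_mul, hab, one_mul]
    simp only [Set.mem_ofPred_eq, dotProduct_add, dotProduct_smul, smul_eq_mul]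
    by_cases hy' : w ⬝ᵥ y < M
    · left
      have := mul_lt_mul_of_pos_left hy' ha
      have := mul_le_mul_of_nonneg_left (hle z hz) hb.le
      linarith
    by_cases hz' : w ⬝ᵥ z < M
    · left
      have := mul_le_mul_of_nonneg_left (hle y hy) ha.le
      have := mul_lt_mul_of_pos_left hz' hb
      linarith
    right
    exact convex_convexHull ℝ _ (hy.resolve_left hy') (hz.resolve_left hz') ha.le hb.le hab
  have : x ∈ {y | w ⬝ᵥ y < M ∨ y ∈ C} := by
    refine convexHull_min (fun t ht => ?_) key hx
    rcases (hT t ht).lt_or_eq with h | h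
    · exact Or.inl h
    · exact Or.inr (subset_convexHull ℝ _ ⟨ht, h⟩)
  exact this.resolve_left hxM.not_lt

theorem Convex.zero_mem_interior_of_forall_exists_smul_mem {n : ℕ} {N : Set (Fin n → ℝ)} (hN : Convex ℝ N)
    (h0 : 0 ∈ N) (h : ∀ w, ∃ ε : ℝ, 0 < ε ∧ ε • w ∈ N) : 0 ∈ interior N := by
  cases n with
  | zero =>
    have : N = Set.univ := Set.eq_univ_of_forall fun x => Subsingleton.elim 0 x ▸ h0
    simp [this]
  | succ n =>
    have hdir : ∀ i : Fin (n + 1), ∃ ε : ℝ, 0 < ε ∧ ∀ t, |t| ≤ ε →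
        (Pi.single i t : Fin (n + 1) → ℝ) ∈ N := by
      intro i
      obtain ⟨a, ha, haN⟩ := h (Pi.single i 1)
      obtain ⟨b, hb, hbN⟩ := h (Pi.single i (-1))
      refine ⟨min a b, lt_min ha hb, fun t ht => ?_⟩
      have hta : |t| ≤ a := ht.trans (min_le_left _ _)
      have htb : |t| ≤ b := ht.trans (min_le_right _ _)
      rcases le_total 0 t with h | h
      · rw [abs_of_nonneg h] at hta
        have := hN.smul_mem_of_zero_mem h0 haN (t := t / a)
          ⟨div_nonneg h ha.le, div_le_one_of_le₀ hta ha.le⟩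
        rwa [smul_smul, div_mul_cancel₀ _ ha.ne', ← Pi.single_smul, smul_eq_mul, mul_one] at this
      · rw [abs_of_nonpos h] at htb
        have := hN.smul_mem_of_zero_mem h0 hbN (t := -t / b)
          ⟨div_nonneg (by linarith) hb.le, div_le_one_of_le₀ htb hb.le⟩
        rwa [smul_smul, div_mul_cancel₀ _ hb.ne', ← Pi.single_smul, smul_eq_mul, neg_mul_neg,
          mul_one] at this
    choose ε hε hεN using hdir
    obtain ⟨i₀, -, hi₀⟩ := Finset.exists_min_image Finset.univ ε ⟨0, Finset.mem_univ _⟩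
    have hn : (0 : ℝ) < n + 1 := by positivity
    rw [mem_interior_iff_mem_nhds, Metric.mem_nhds_iff]
    refine ⟨ε i₀ / (n + 1), div_pos (hε _) hn, fun x hx => ?_⟩
    rw [mem_ball_zero_iff] at hx
    -- `x` is the average of the `n + 1` axis points `(n + 1) x_i e_i`, each within the smallest
    -- axis radius; hence the ball radius `ε i₀ / (n + 1)`.
    have hsum : x = ∑ i, (1 / (n + 1) : ℝ) • (Pi.single i ((n + 1) * x i) : Fin (n + 1) → ℝ) := by
      conv_lhs => rw [← Finset.univ_sum_single x]
      refine Finset.sum_congr rfl fun i _ => ?_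
      rw [← Pi.single_smul, smul_eq_mul, ← mul_assoc, one_div, inv_mul_cancel₀ hn.ne', one_mul]
    rw [hsum]
    refine hN.sum_mem (fun _ _ => by positivity) ?_ fun i _ => hεN i _ ?_
    · simp [hn.ne']
    · rw [abs_mul, abs_of_pos hn]
      have h1 : |x i| ≤ ε i₀ / (n + 1) := (norm_le_pi_norm x i).trans hx.le
      rw [le_div_iff₀ hn] at h1
      linarith [hi₀ i (Finset.mem_univ _)]

/-! ### From a polytopal fan to a simplicial polytope. -/

/-- `φ` spans a complete simplicial fan with face complex `Δ`, and each of its cones is cut out by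
a hyperplane that supports the points `φ v`. -/
structure IsPolytopalFan {V : Type*} {n : ℕ} (Δ : Set (Finset V)) (φ : V → (Fin n → ℝ)) :
    Prop where
  isLowerSet : IsLowerSet Δ
  exists_eq_sum : ∀ w : Fin n → ℝ, ∃ σ ∈ Δ, ∃ c : V → ℝ, (∀ v ∈ σ, 0 < c v) ∧
    w = ∑ v ∈ σ, c v • φ v
  exists_support : ∀ σ ∈ Δ, ∃ q : Fin n → ℝ, (∀ v ∈ σ, q ⬝ᵥ φ v = 1) ∧
    ∀ v, {v} ∈ Δ → v ∉ σ → q ⬝ᵥ φ v < 1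

/-- The convex hull of the origin and of the points `φ v` for the vertices `v` of `Δ`. -/
def fanPolytope {V : Type*} {n : ℕ} (Δ : Set (Finset V)) (φ : V → (Fin n → ℝ)) :
    Set (Fin n → ℝ) :=
  convexHull ℝ (insert 0 (φ '' {v | {v} ∈ Δ}))

namespace IsPolytopalFan

variable {V : Type*} {n : ℕ} {Δ : Set (Finset V)} {φ : V → (Fin n → ℝ)}

theorem singleton_mem (h : IsPolytopalFan Δ φ) {σ : Finset V} (hσ : σ ∈ Δ) {v : V} (hv : v ∈ σ) :
    {v} ∈ Δ :=
  h.isLowerSet (Finset.singleton_subset_iff.2 hv) hσ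

theorem empty_mem (h : IsPolytopalFan Δ φ) : ∅ ∈ Δ := by
  obtain ⟨σ, hσ, -⟩ := h.exists_eq_sum 0
  exact h.isLowerSet (Finset.empty_subset σ) hσ

theorem zero_mem_fanPolytope : 0 ∈ fanPolytope Δ φ :=
  subset_convexHull ℝ _ (Set.mem_insert _ _)

theorem apply_mem_fanPolytope {v : V} (hv : {v} ∈ Δ) : φ v ∈ fanPolytope Δ φ :=
  subset_convexHull ℝ _ (Set.mem_insert_of_mem _ ⟨v, hv, rfl⟩)

theorem convexHull_subset_fanPolytope (h : IsPolytopalFan Δ φ) {σ : Finset V} (hσ : σ ∈ Δ) :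
    convexHull ℝ (φ '' (σ : Set V)) ⊆ fanPolytope Δ φ :=
  convexHull_mono <| (Set.image_mono fun _ hv => h.singleton_mem hσ hv).trans
    (Set.subset_insert _ _)

theorem zero_mem_interior_fanPolytope (h : IsPolytopalFan Δ φ) :
    0 ∈ interior (fanPolytope Δ φ) := by
  refine (convex_convexHull ℝ _).zero_mem_interior_of_forall_exists_smul_mem zero_mem_fanPolytope fun w => ?_
  obtain ⟨σ, hσ, c, hc, rfl⟩ := h.exists_eq_sum w
  rcases σ.eq_empty_or_nonempty with rfl | hne
  · refine ⟨1, one_pos, ?_⟩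
    rw [Finset.sum_empty, smul_zero]
    exact zero_mem_fanPolytope
  have hpos : 0 < ∑ v ∈ σ, c v := Finset.sum_pos hc hne
  refine ⟨(∑ v ∈ σ, c v)⁻¹, inv_pos.2 hpos, ?_⟩
  rw [Finset.smul_sum]
  simp_rw [smul_smul]
  refine (convex_convexHull ℝ _).sum_mem (fun v hv => ?_) ?_ fun v hv =>
    apply_mem_fanPolytope (h.singleton_mem hσ hv)
  · have := hc v hv
    positivity
  · rw [← Finset.mul_sum, inv_mul_cancel₀ hpos.ne']

/-- The vertices on which a supporting functional attains its bound form a face. -/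
theorem mem_of_support (h : IsPolytopalFan Δ φ) {q : Fin n → ℝ}
    (hq : ∀ v, {v} ∈ Δ → q ⬝ᵥ φ v ≤ 1) {S : Finset V}
    (hS : ∀ v ∈ S, {v} ∈ Δ ∧ q ⬝ᵥ φ v = 1) : S ∈ Δ := by
  -- Evaluate the vector `∑ v ∈ S, φ v` by `q` and by the functional `r` of its cone `σ`: `|S| =
  -- q(·) ≤ ∑ c = r(·) ≤ |S|`. Equality forces `r = 1` at each point of `S`, so `S ⊆ σ`.
  obtain ⟨σ, hσ, c, hc, hw⟩ := h.exists_eq_sum (∑ v ∈ S, φ v)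
  obtain ⟨r, hr, hr'⟩ := h.exists_support σ hσ
  have hrle : ∀ v ∈ S, r ⬝ᵥ φ v ≤ 1 := fun v hv => by
    by_cases hvσ : v ∈ σ
    · exact (hr v hvσ).le
    · exact (hr' v (hS v hv).1 hvσ).le
  have h1 : ∑ v ∈ S, r ⬝ᵥ φ v = ∑ v ∈ σ, c v := by
    rw [← dotProduct_sum, hw, dotProduct_sum]
    refine Finset.sum_congr rfl fun v hv => ?_
    rw [dotProduct_smul, hr v hv, smul_eq_mul, mul_one]
  have h2 : ∑ v ∈ S, (1 : ℝ) ≤ ∑ v ∈ σ, c v := by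
    calc ∑ v ∈ S, (1 : ℝ) = ∑ v ∈ S, q ⬝ᵥ φ v :=
          Finset.sum_congr rfl fun v hv => (hS v hv).2.symm
      _ = ∑ v ∈ σ, c v * q ⬝ᵥ φ v := by
          rw [← dotProduct_sum, hw, dotProduct_sum]
          exact Finset.sum_congr rfl fun v _ => dotProduct_smul _ _ _
      _ ≤ ∑ v ∈ σ, c v := Finset.sum_le_sum fun v hv =>
          mul_le_of_le_one_right (hc v hv).le (hq v (h.singleton_mem hσ hv))
  have h3 : ∑ v ∈ S, r ⬝ᵥ φ v = ∑ v ∈ S, (1 : ℝ) :=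
    le_antisymm (Finset.sum_le_sum hrle) (h1 ▸ h2)
  refine h.isLowerSet (fun v hv => ?_) hσ
  by_contra hvσ
  exact (hr' v (hS v hv).1 hvσ).ne ((Finset.sum_eq_sum_iff_of_le hrle).1 h3 v hv)

theorem exists_fanPolytope_support (h : IsPolytopalFan Δ φ) {σ : Finset V} (hσ : σ ∈ Δ) :
    ∃ q : Fin n → ℝ, (∀ x ∈ fanPolytope Δ φ, q ⬝ᵥ x ≤ 1) ∧
      (∀ x ∈ fanPolytope Δ φ, x ∈ convexHull ℝ (φ '' (σ : Set V)) ↔ q ⬝ᵥ x = 1) ∧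
      ∀ v, {v} ∈ Δ → (v ∈ σ ↔ q ⬝ᵥ φ v = 1) := by
  obtain ⟨q, hq, hq'⟩ := h.exists_support σ hσ
  have hmem : ∀ v, {v} ∈ Δ → (v ∈ σ ↔ q ⬝ᵥ φ v = 1) := fun v hv =>
    ⟨hq v, fun h1 => by_contra fun hvσ => (hq' v hv hvσ).ne h1⟩
  have hT : ∀ t ∈ insert 0 (φ '' {v | {v} ∈ Δ}), q ⬝ᵥ t ≤ 1 := by
    rintro t (rfl | ⟨v, hv, rfl⟩)
    · simp
    · by_cases hvσ : v ∈ σ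
      · exact (hq v hvσ).le
      · exact (hq' v hv hvσ).le
  refine ⟨q, fun x hx => dotProduct_le_of_mem_convexHull hT hx, fun x hx => ⟨fun hx' => ?_,
    fun hx1 => ?_⟩, hmem⟩
  · refine dotProduct_eq_of_mem_convexHull ?_ hx'
    rintro _ ⟨v, hv, rfl⟩
    exact hq v hv
  · refine convexHull_mono ?_ (mem_convexHull_of_dotProduct_eq hT hx hx1)
    -- The extra generator `0` has value `0`, not `1`, so it never lies on the supporting
    -- hyperplane.
    rintro _ ⟨rfl | ⟨v, hv, rfl⟩, h1⟩
    · simp at h1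
    · exact ⟨v, (hmem v hv).2 h1, rfl⟩

theorem convexHull_mem_properFaces (h : IsPolytopalFan Δ φ) {σ : Finset V} (hσ : σ ∈ Δ) :
    convexHull ℝ (φ '' (σ : Set V)) ∈ properFaces (fanPolytope Δ φ) := by
  obtain ⟨q, hq, hq', -⟩ := h.exists_fanPolytope_support hσ
  constructor
  · rw [isExposed_iff_dotProduct]
    rintro ⟨z, hz⟩
    have hzN := h.convexHull_subset_fanPolytope hσ hz
    refine ⟨q, Set.ext fun x => ⟨fun hx => ?_, fun hx => ?_⟩⟩
    · have hxN := h.convexHull_subset_fanPolytope hσ hx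
      exact ⟨hxN, fun y hy => (hq y hy).trans_eq ((hq' x hxN).1 hx).symm⟩
    · refine (hq' x hx.1).2 (le_antisymm (hq x hx.1) ?_)
      exact ((hq' z hzN).1 hz).symm.trans_le (hx.2 z hzN)
  · intro heq
    have h0 : (0 : Fin n → ℝ) ∈ convexHull ℝ (φ '' (σ : Set V)) := heq ▸ zero_mem_fanPolytope
    simpa using (hq' 0 zero_mem_fanPolytope).1 h0

theorem exists_of_mem_properFaces [Finite V] (h : IsPolytopalFan Δ φ) {F : Set (Fin n → ℝ)}
    (hF : F ∈ properFaces (fanPolytope Δ φ)) :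
    ∃ σ ∈ Δ, convexHull ℝ (φ '' (σ : Set V)) = F := by
  classical
  have := Fintype.ofFinite V
  obtain ⟨hF, hne⟩ := hF
  rcases F.eq_empty_or_nonempty with rfl | hFne
  · exact ⟨∅, h.empty_mem, by simp⟩
  obtain ⟨w, hw⟩ := isExposed_iff_dotProduct.1 hF hFne
  obtain ⟨z, hz⟩ := hFne
  obtain ⟨hzN, hzmax⟩ : z ∈ fanPolytope Δ φ ∧ ∀ y ∈ fanPolytope Δ φ, w ⬝ᵥ y ≤ w ⬝ᵥ z := by
    rwa [hw] at hz
  have hle0 : 0 ≤ w ⬝ᵥ z := by simpa using hzmax 0 zero_mem_fanPolytope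
  have hpos : 0 < w ⬝ᵥ z := by
    -- If the maximum were `0`, expanding one factor of `w ⬝ᵥ w` over the fan would give `w ⬝ᵥ w ≤
    -- 0`, so `w = 0` and the face would be everything.
    refine hle0.lt_of_ne fun h0 => hne ?_
    obtain ⟨σ, hσ, c, hc, hwσ⟩ := h.exists_eq_sum w
    have hw0 : w ⬝ᵥ w ≤ 0 := by
      conv_lhs => rw [hwσ, sum_dotProduct]
      refine Finset.sum_nonpos fun v hv => ?_
      rw [smul_dotProduct, dotProduct_comm, ← hwσ, smul_eq_mul]
      exact mul_nonpos_of_nonneg_of_nonpos (hc v hv).le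
        (h0 ▸ hzmax _ (apply_mem_fanPolytope (h.singleton_mem hσ hv)))
    have : w = 0 := dotProduct_self_eq_zero.1
      (le_antisymm hw0 (Finset.sum_nonneg fun i _ => mul_self_nonneg (w i)))
    rw [hw, this]
    simp
  set M := w ⬝ᵥ z
  have hT : ∀ v, {v} ∈ Δ → w ⬝ᵥ φ v ≤ M := fun v hv => hzmax _ (apply_mem_fanPolytope hv)
  set σ : Finset V := Finset.univ.filter fun v => {v} ∈ Δ ∧ w ⬝ᵥ φ v = M with hσdef
  have hσ : σ ∈ Δ := by
    refine h.mem_of_support (q := M⁻¹ • w) (fun v hv => ?_) fun v hv => ?_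
    · rw [smul_dotProduct, smul_eq_mul, inv_mul_le_one₀ hpos]
      exact hT v hv
    · rw [hσdef, Finset.mem_filter] at hv
      refine ⟨hv.2.1, ?_⟩
      rw [smul_dotProduct, smul_eq_mul, hv.2.2, inv_mul_cancel₀ hpos.ne']
  refine ⟨σ, hσ, Set.Subset.antisymm (fun x hx => ?_) fun x hx => ?_⟩
  · rw [hw]
    refine ⟨h.convexHull_subset_fanPolytope hσ hx, fun y hy => (hzmax y hy).trans_eq ?_⟩
    refine (dotProduct_eq_of_mem_convexHull ?_ hx).symm
    rintro _ ⟨v, hv, rfl⟩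
    exact (Finset.mem_filter.1 (Finset.mem_coe.1 hv)).2.2
  · rw [hw] at hx
    have hxM : w ⬝ᵥ x = M := le_antisymm (hzmax x hx.1) (hx.2 z hzN)
    refine convexHull_mono ?_ (mem_convexHull_of_dotProduct_eq (w := w) (M := M) ?_ hx.1 hxM)
    · rintro _ ⟨rfl | ⟨v, hv, rfl⟩, h1⟩
      · rw [dotProduct_zero] at h1
        exact absurd h1 hpos.ne
      · exact ⟨v, by simpa [hσdef] using ⟨hv, h1⟩, rfl⟩
    · rintro _ (rfl | ⟨v, hv, rfl⟩)
      · simpa using hle0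
      · exact hT v hv

/-- The difference of the supporting functionals of `σ` and of `σ.erase v` vanishes on the other
points of `σ` and is positive at `φ v`. This isolates each coefficient; the points are even linearly
independent. -/
theorem affineIndependent_image [DecidableEq V] (h : IsPolytopalFan Δ φ) {σ : Finset V}
    (hσ : σ ∈ Δ) :
    AffineIndependent ℝ ((↑) : σ.image φ → (Fin n → ℝ)) := by
  rw [affineIndependent_iff]
  rintro s a - hs ⟨e, he⟩ hes
  obtain ⟨v, hv, rfl⟩ := Finset.mem_image.1 he
  obtain ⟨q, hq, -⟩ := h.exists_support σ hσ
  obtain ⟨r, hr, hr'⟩ := h.exists_support (σ.erase v)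
    (h.isLowerSet (Finset.erase_subset v σ) hσ)
  have hlt : r ⬝ᵥ φ v < 1 := hr' v (h.singleton_mem hσ hv) (Finset.notMem_erase v σ)
  have hsum := congrArg (fun x => (q - r) ⬝ᵥ x) hs
  simp only [dotProduct_sum, dotProduct_smul, dotProduct_zero, smul_eq_mul] at hsum
  rw [Finset.sum_eq_single_of_mem _ hes] at hsum
  · refine (mul_eq_zero.1 hsum).resolve_right ?_
    simp only [sub_dotProduct, hq v hv]
    linarith
  · rintro ⟨e, he⟩ - hne
    obtain ⟨u, hu, rfl⟩ := Finset.mem_image.1 he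
    have huv : u ≠ v := by
      rintro rfl
      exact hne rfl
    simp [sub_dotProduct, hq u hu, hr u (Finset.mem_erase.2 ⟨huv, hu⟩)]

theorem subset_of_convexHull_subset (h : IsPolytopalFan Δ φ) {σ τ : Finset V} (hσ : σ ∈ Δ)
    (hτ : τ ∈ Δ) (hsub : convexHull ℝ (φ '' (σ : Set V)) ⊆ convexHull ℝ (φ '' (τ : Set V))) :
    σ ⊆ τ := by
  obtain ⟨q, -, hq, hq'⟩ := h.exists_fanPolytope_support hτ
  intro v hv
  have hvΔ := h.singleton_mem hσ hv
  exact (hq' v hvΔ).2 ((hq _ (apply_mem_fanPolytope hvΔ)).1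
    (hsub (subset_convexHull ℝ _ ⟨v, hv, rfl⟩)))

theorem isBoundaryRealization [Finite V] (h : IsPolytopalFan Δ φ) :
    IsBoundaryRealization Δ (fanPolytope Δ φ) φ := by
  classical
  refine ⟨⟨?_, fun F hF => ?_⟩, ⟨fun σ hσ => h.convexHull_mem_properFaces hσ,
    fun σ hσ τ hτ hστ => ?_, fun F hF => h.exists_of_mem_properFaces hF⟩, fun σ hσ τ hτ =>
    ⟨fun hστ => convexHull_mono (Set.image_mono (Finset.coe_subset.2 hστ)),
      h.subset_of_convexHull_subset hσ hτ⟩⟩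
  · have hfin : (insert 0 (φ '' {v | {v} ∈ Δ})).Finite := (Set.toFinite _).insert _
    exact ⟨hfin.toFinset, by rw [hfin.coe_toFinset, fanPolytope]⟩
  · obtain ⟨σ, hσ, rfl⟩ := h.exists_of_mem_properFaces hF
    exact ⟨σ.image φ, h.affineIndependent_image hσ, by rw [Finset.coe_image]⟩
  · exact (h.subset_of_convexHull_subset hσ hτ hστ.subset).antisymm
      (h.subset_of_convexHull_subset hτ hσ hστ.symm.subset)

theorem polarDual_fanPolytope :
    polarDual (fanPolytope Δ φ) = {y | ∀ v, {v} ∈ Δ → y ⬝ᵥ φ v ≤ 1} := by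
  refine Set.ext fun y => ⟨fun hy v hv => hy _ (apply_mem_fanPolytope hv), fun hy x hx =>
    dotProduct_le_of_mem_convexHull ?_ hx⟩
  rintro _ (rfl | ⟨v, hv, rfl⟩)
  · simp
  · exact hy v hv

end IsPolytopalFan

/-! ### From a simplicial normal fan to the face lattice and the polar dual. -/

/-- The points of `P` that maximize over `P` all the functionals `ν v` with `v ∈ σ`. -/
def optimalFace {V : Type*} {n : ℕ} (P : Set (Fin n → ℝ)) (ν : V → (Fin n → ℝ))
    (σ : Finset V) : Set (Fin n → ℝ) :=
  {x | x ∈ P ∧ ∀ v ∈ σ, ∀ y ∈ P, ν v ⬝ᵥ y ≤ ν v ⬝ᵥ x}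

/-- The vectors `ν v` span a simplicial fan with face complex `Δ` that is the normal fan of the
polytope `P`. -/
structure IsSimplicialNormalFan {V : Type*} {n : ℕ} (Δ : Set (Finset V)) (ν : V → (Fin n → ℝ))
    (P : Set (Fin n → ℝ)) : Prop where
  isLowerSet : IsLowerSet Δ
  exists_eq_sum : ∀ w : Fin n → ℝ, ∃ σ ∈ Δ, ∃ c : V → ℝ, (∀ v ∈ σ, 0 < c v) ∧
    w = ∑ v ∈ σ, c v • ν v
  nonempty : ∀ σ ∈ Δ, (optimalFace P ν σ).Nonempty
  exists_lt : ∀ σ ∈ Δ, ∀ v, {v} ∈ Δ → v ∉ σ →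
    ∃ x ∈ optimalFace P ν σ, ∃ y ∈ P, ν v ⬝ᵥ x < ν v ⬝ᵥ y

namespace IsSimplicialNormalFan

variable {V : Type*} {n : ℕ} {Δ : Set (Finset V)} {ν : V → (Fin n → ℝ)} {P : Set (Fin n → ℝ)}

theorem singleton_mem (h : IsSimplicialNormalFan Δ ν P) {σ : Finset V} (hσ : σ ∈ Δ) {v : V}
    (hv : v ∈ σ) : {v} ∈ Δ :=
  h.isLowerSet (Finset.singleton_subset_iff.2 hv) hσ

theorem empty_mem (h : IsSimplicialNormalFan Δ ν P) : ∅ ∈ Δ := by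
  obtain ⟨σ, hσ, -⟩ := h.exists_eq_sum 0
  exact h.isLowerSet (Finset.empty_subset σ) hσ

/-- Since some point maximizes all `ν v` with `v ∈ σ` at once, a positive combination is maximal
only where every term is. -/
theorem maximizers_eq_optimalFace (h : IsSimplicialNormalFan Δ ν P) {σ : Finset V} (hσ : σ ∈ Δ)
    {c : V → ℝ} (hc : ∀ v ∈ σ, 0 < c v) {w : Fin n → ℝ} (hw : w = ∑ v ∈ σ, c v • ν v) :
    {x | x ∈ P ∧ ∀ y ∈ P, w ⬝ᵥ y ≤ w ⬝ᵥ x} = optimalFace P ν σ := by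
  have hdot : ∀ x, w ⬝ᵥ x = ∑ v ∈ σ, c v * ν v ⬝ᵥ x := fun x => by
    simp [hw, sum_dotProduct, smul_dotProduct]
  refine Set.ext fun x => ⟨fun hx => ⟨hx.1, ?_⟩, fun hx => ⟨hx.1, fun y hy => ?_⟩⟩
  · obtain ⟨z, hzP, hz⟩ := h.nonempty σ hσ
    have hle : ∀ v ∈ σ, c v * ν v ⬝ᵥ x ≤ c v * ν v ⬝ᵥ z := fun v hv =>
      mul_le_mul_of_nonneg_left (hz v hv x hx.1) (hc v hv).le
    have heq := le_antisymm (Finset.sum_le_sum hle) (by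
      rw [← hdot, ← hdot]
      exact hx.2 z hzP)
    intro v hv y hy
    have := mul_left_cancel₀ (hc v hv).ne' ((Finset.sum_eq_sum_iff_of_le hle).1 heq v hv)
    rw [this]
    exact hz v hv y hy
  · rw [hdot, hdot]
    exact Finset.sum_le_sum fun v hv => mul_le_mul_of_nonneg_left (hx.2 v hv y hy) (hc v hv).le

theorem subset_iff (h : IsSimplicialNormalFan Δ ν P) {σ τ : Finset V} (hσ : σ ∈ Δ)
    (hτ : τ ∈ Δ) : σ ⊆ τ ↔ optimalFace P ν τ ⊆ optimalFace P ν σ := by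
  refine ⟨fun hστ x hx => ⟨hx.1, fun v hv => hx.2 v (hστ hv)⟩, fun hsub v hv => ?_⟩
  by_contra hvτ
  obtain ⟨x, hx, y, hy, hlt⟩ := h.exists_lt τ hτ v (h.singleton_mem hσ hv) hvτ
  exact hlt.not_ge ((hsub hx).2 v hv y hy)

theorem bijOn_optimalFace (h : IsSimplicialNormalFan Δ ν P) :
    Set.BijOn (optimalFace P ν) Δ {F | IsExposed ℝ P F ∧ F.Nonempty} := by
  refine ⟨fun σ hσ => ⟨isExposed_iff_dotProduct.2 fun _ => ⟨_,
    (h.maximizers_eq_optimalFace hσ (c := 1) (fun _ _ => one_pos) rfl).symm⟩, h.nonempty σ hσ⟩,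
    fun σ hσ τ hτ hστ => ?_, fun F hF => ?_⟩
  · exact ((h.subset_iff hσ hτ).2 hστ.symm.subset).antisymm
      ((h.subset_iff hτ hσ).2 hστ.subset)
  · obtain ⟨w, hw⟩ := isExposed_iff_dotProduct.1 hF.1 hF.2
    obtain ⟨σ, hσ, c, hc, hwσ⟩ := h.exists_eq_sum w
    exact ⟨σ, hσ, by rw [hw, h.maximizers_eq_optimalFace hσ hc hwσ]⟩

/-- Each face of `P` contains a point that lies on no other facets than those forced to. -/
theorem exists_forall_lt [Finite V] (h : IsSimplicialNormalFan Δ ν P) (hP : Convex ℝ P)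
    {σ : Finset V} (hσ : σ ∈ Δ) :
    ∃ x ∈ optimalFace P ν σ, ∀ v, {v} ∈ Δ → v ∉ σ → ∃ y ∈ P, ν v ⬝ᵥ x < ν v ⬝ᵥ y := by
  classical
  have := Fintype.ofFinite V
  suffices H : ∀ S : Finset V, ∃ x ∈ optimalFace P ν σ,
      ∀ v ∈ S, {v} ∈ Δ → v ∉ σ → ∃ y ∈ P, ν v ⬝ᵥ x < ν v ⬝ᵥ y by
    obtain ⟨x, hx, hlt⟩ := H Finset.univ
    exact ⟨x, hx, fun v => hlt v (Finset.mem_univ v)⟩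
  intro S
  induction S using Finset.induction_on with
  | empty =>
    obtain ⟨x, hx⟩ := h.nonempty σ hσ
    exact ⟨x, hx, by simp⟩
  | insert u S _ ih =>
    obtain ⟨x, hx, hlt⟩ := ih
    by_cases hu : {u} ∈ Δ ∧ u ∉ σ
    swap
    · refine ⟨x, hx, fun v hv hvΔ hvσ => ?_⟩
      rcases Finset.mem_insert.1 hv with rfl | hv
      · exact absurd ⟨hvΔ, hvσ⟩ hu
      · exact hlt v hv hvΔ hvσ
    -- The midpoint of `x` and `z` stays in the face, and it is off the facet of `v` as soon as one
    -- of `x`, `z` is.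
    obtain ⟨z, hz, hlt'⟩ := h.exists_lt σ hσ u hu.1 hu.2
    have hdot : ∀ v, ν v ⬝ᵥ ((1 / 2 : ℝ) • x + (1 / 2 : ℝ) • z) =
        (ν v ⬝ᵥ x + ν v ⬝ᵥ z) / 2 := fun v => by
      rw [dotProduct_add, dotProduct_smul, dotProduct_smul, smul_eq_mul, smul_eq_mul]
      ring
    have hmem : (1 / 2 : ℝ) • x + (1 / 2 : ℝ) • z ∈ P :=
      hP hx.1 hz.1 (by norm_num) (by norm_num) (by norm_num)
    refine ⟨_, ⟨hmem, fun v hv y hy => ?_⟩, fun v hv hvΔ hvσ => ?_⟩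
    · rw [hdot]
      linarith [hx.2 v hv y hy, hz.2 v hv y hy]
    · have : (∃ y ∈ P, ν v ⬝ᵥ x < ν v ⬝ᵥ y) ∨ ∃ y ∈ P, ν v ⬝ᵥ z < ν v ⬝ᵥ y := by
        rcases Finset.mem_insert.1 hv with rfl | hv
        · exact Or.inr hlt'
        · exact Or.inl (hlt v hv hvΔ hvσ)
      obtain ⟨m, hm, hmax⟩ := h.nonempty {v} hvΔ
      have hmax := hmax v (Finset.mem_singleton_self v)
      refine ⟨m, hm, ?_⟩
      rw [hdot]
      rcases this with ⟨y, hy, hlt⟩ | ⟨y, hy, hlt⟩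
      · linarith [hmax y hy, hmax z hz.1]
      · linarith [hmax y hy, hmax x hx.1]

/-- With `p` off every facet and `g v > 0` its slack at `v`, the inequality `ν v ⬝ᵥ x ≤ b v` becomes
`(x - p) ⬝ᵥ φ v ≤ 1` for `φ v = (g v)⁻¹ • ν v`. A point `x` of `F_σ` on no further facets then gives
the supporting functional `x - p` of `σ`. -/
theorem exists_isPolytopalFan [Finite V] (h : IsSimplicialNormalFan Δ ν P) (hP : Convex ℝ P)
    (hPc : IsClosed P) : ∃ (φ : V → (Fin n → ℝ)) (p : Fin n → ℝ), IsPolytopalFan Δ φ ∧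
      polarDual (fanPolytope Δ φ) = {y | y + p ∈ P} := by
  classical
  obtain ⟨p, hp, hlt⟩ := h.exists_forall_lt hP h.empty_mem
  have hval : ∀ v, ∃ b : ℝ, {v} ∈ Δ → (∀ y ∈ P, ν v ⬝ᵥ y ≤ b) ∧ ν v ⬝ᵥ p < b ∧
      ∃ z ∈ P, ν v ⬝ᵥ z = b := by
    intro v
    by_cases hv : {v} ∈ Δ
    · obtain ⟨z, hz, hmax⟩ := h.nonempty {v} hv
      have hmax := hmax v (Finset.mem_singleton_self v)
      obtain ⟨y, hy, hlt⟩ := hlt v hv (Finset.notMem_empty v)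
      exact ⟨ν v ⬝ᵥ z, fun _ => ⟨hmax, hlt.trans_le (hmax y hy), z, hz, rfl⟩⟩
    · exact ⟨0, fun hv' => absurd hv' hv⟩
  choose b hb using hval
  set g : V → ℝ := fun v => b v - ν v ⬝ᵥ p
  have hgpos : ∀ v, {v} ∈ Δ → 0 < g v := fun v hv => sub_pos.2 (hb v hv).2.1
  have hdot : ∀ v x, (x - p) ⬝ᵥ ((g v)⁻¹ • ν v) = (ν v ⬝ᵥ x - ν v ⬝ᵥ p) / g v := fun v x => by
    rw [dotProduct_smul, dotProduct_comm, dotProduct_sub, smul_eq_mul, div_eq_inv_mul]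
  have hle1 : ∀ v, {v} ∈ Δ → ∀ x, (x - p) ⬝ᵥ ((g v)⁻¹ • ν v) ≤ 1 ↔ ν v ⬝ᵥ x ≤ b v :=
    fun v hv x => by
      rw [hdot, div_le_one (hgpos v hv)]
      exact sub_le_sub_iff_right _
  have hlt1 : ∀ v, {v} ∈ Δ → ∀ x, (x - p) ⬝ᵥ ((g v)⁻¹ • ν v) < 1 ↔ ν v ⬝ᵥ x < b v :=
    fun v hv x => by
      rw [hdot, div_lt_one (hgpos v hv)]
      exact sub_lt_sub_iff_right _
  refine ⟨fun v => (g v)⁻¹ • ν v, p, ⟨h.isLowerSet, fun w => ?_, fun σ hσ => ?_⟩, ?_⟩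
  · obtain ⟨σ, hσ, c, hc, rfl⟩ := h.exists_eq_sum w
    refine ⟨σ, hσ, fun v => c v * g v,
      fun v hv => mul_pos (hc v hv) (hgpos v (h.singleton_mem hσ hv)), ?_⟩
    refine Finset.sum_congr rfl fun v hv => ?_
    have := (hgpos v (h.singleton_mem hσ hv)).ne'
    rw [smul_smul, mul_assoc, mul_inv_cancel₀ this, mul_one]
  · obtain ⟨x, hx, hxlt⟩ := h.exists_forall_lt hP hσ
    refine ⟨x - p, fun v hv => ?_, fun v hv hvσ => ?_⟩
    · have hvΔ := h.singleton_mem hσ hv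
      refine le_antisymm ((hle1 v hvΔ x).2 ((hb v hvΔ).1 x hx.1)) (not_lt.1 fun hlt => ?_)
      obtain ⟨z, hz, hzb⟩ := (hb v hvΔ).2.2
      exact ((hlt1 v hvΔ x).1 hlt).not_ge (hzb ▸ hx.2 v hv z hz)
    · obtain ⟨y, hy, hlt⟩ := hxlt v hv hvσ
      exact (hlt1 v hv x).2 (hlt.trans_le ((hb v hv).1 y hy))
  · rw [IsPolytopalFan.polarDual_fanPolytope]
    refine Set.ext fun y => ⟨fun hy => ?_, fun hy v hv => ?_⟩
    · replace hy : ∀ v, {v} ∈ Δ → ν v ⬝ᵥ (y + p) ≤ b v := fun v hv => by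
        rw [← hle1 v hv, add_sub_cancel_right]
        exact hy v hv
      by_contra hyP
      -- A separating functional is a positive combination over some `σ`, and its maximum over `P`
      -- is attained on `F_σ`, so the facet inequalities already bound it at `y + p`.
      obtain ⟨l, u, hl, hlu⟩ := geometric_hahn_banach_closed_point hP hPc hyP
      obtain ⟨w, hw⟩ := StrongDual.exists_eq_dotProduct l
      obtain ⟨σ, hσ, c, hc, rfl⟩ := h.exists_eq_sum w
      obtain ⟨z, hzP, hz⟩ := h.nonempty σ hσ
      have : l (y + p) ≤ l z := by
        rw [hw, hw, sum_dotProduct, sum_dotProduct]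
        refine Finset.sum_le_sum fun v hv => ?_
        rw [smul_dotProduct, smul_dotProduct]
        obtain ⟨-, -, t, ht, htb⟩ := hb v (h.singleton_mem hσ hv)
        exact mul_le_mul_of_nonneg_left ((hy v (h.singleton_mem hσ hv)).trans
          (htb ▸ hz v hv t ht)) (hc v hv).le
      linarith [hl z hzP]
    · have := (hle1 v hv (y + p)).2 ((hb v hv).1 _ hy)
      rwa [add_sub_cancel_right] at this

end IsSimplicialNormalFan

/-! ### Translation invariance of the face lattice. -/

theorem IsExposed.preimage_add_right {n : ℕ} {P F : Set (Fin n → ℝ)} (hF : IsExposed ℝ P F)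
    (p : Fin n → ℝ) : IsExposed ℝ {y | y + p ∈ P} {y | y + p ∈ F} := by
  rintro ⟨y, hy⟩
  obtain ⟨l, rfl⟩ := hF ⟨_, hy⟩
  refine ⟨l, Set.ext fun x => and_congr_right fun _ => ⟨fun hx z hz => ?_, fun hx z hz => ?_⟩⟩
  · simpa using hx _ hz
  · have := hx (z - p) (by simpa using hz)
    rw [map_sub] at this
    rw [map_add]
    linarith

theorem combinatoriallyIsomorphic_preimage_add_right {n : ℕ} (P : Set (Fin n → ℝ))
    (p : Fin n → ℝ) : CombinatoriallyIsomorphic P {y | y + p ∈ P} := by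
  refine ⟨{
    toFun := fun F => ⟨{y | y + p ∈ F.1}, F.2.preimage_add_right p⟩
    invFun := fun G => ⟨{y | y + -p ∈ G.1}, ?_⟩
    left_inv := fun F => Subtype.ext (Set.ext fun x => by simp)
    right_inv := fun G => Subtype.ext (Set.ext fun x => by simp)
    map_rel_iff' := fun {F G} => ⟨fun hFG x hx => ?_, fun hFG x hx => hFG hx⟩ }⟩
  · simpa using G.2.preimage_add_right (-p)
  · have : x - p ∈ {y | y + p ∈ F.1} := by simpa using hx
    simpa using hFG this

theorem IsSimplicialNormalFan.isExtendedNestohedron {n : ℕ} {B : Finset (Finset (Fin n))}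
    {ν : NestedVertex n → (Fin n → ℝ)} {P : Set (Fin n → ℝ)}
    (h : IsSimplicialNormalFan (extendedNestedComplex B) ν P) (hP : IsPolytope P) :
    IsExtendedNestohedron B P := by
  obtain ⟨s, hs⟩ := id hP
  obtain ⟨φ, p, hφ, hpolar⟩ := h.exists_isPolytopalFan (hs ▸ convex_convexHull ℝ _)
    (hs ▸ (s.finite_toSet.isCompact_convexHull ℝ).isClosed)
  refine ⟨hP, fanPolytope (extendedNestedComplex B) φ, φ, hφ.isBoundaryRealization,
    hφ.zero_mem_interior_fanPolytope, ?_⟩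
  rw [hpolar]
  exact combinatoriallyIsomorphic_preimage_add_right P p

/-! ### Building sets and nested decompositions. -/

section Combinatorics

variable {n : ℕ} {B : Finset (Finset (Fin n))}

theorem basisSum_apply (S : Finset (Fin n)) (i : Fin n) :
    basisSum S i = if i ∈ S then 1 else 0 := by
  simp [basisSum, Finset.sum_apply, Pi.single_apply]

theorem basisSum_dotProduct (S : Finset (Fin n)) (x : Fin n → ℝ) :
    basisSum S ⬝ᵥ x = ∑ i ∈ S, x i := by
  simp [basisSum, sum_dotProduct]

theorem basisSum_dotProduct_basisSum (S T : Finset (Fin n)) :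
    basisSum S ⬝ᵥ basisSum T = ((S ∩ T).card : ℝ) := by
  simp [basisSum_dotProduct, basisSum_apply]

theorem IsBuildingSet.union_biUnion_mem (hB : IsBuildingSet B) {I : Finset (Fin n)} (hI : I ∈ B)
    (T : Finset (Finset (Fin n))) (hT : ∀ J ∈ T, J ∈ B ∧ (I ∩ J).Nonempty) :
    I ∪ T.biUnion id ∈ B := by
  induction T using Finset.induction_on with
  | empty => simpa using hI
  | insert J T _ ih =>
    have hJ := hT J (Finset.mem_insert_self _ _)
    have := hB.union_mem _ (ih fun K hK => hT K (Finset.mem_insert_of_mem hK)) J hJ.1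
      (hJ.2.mono (Finset.inter_subset_inter_right Finset.subset_union_left))
    rwa [Finset.union_assoc, Finset.union_comm _ J, ← id_eq J, ← Finset.biUnion_insert] at this

/-- An element of the building set covered by a nested collection lies in one of its members. -/
theorem IsExtendedNested.exists_superset (hB : IsBuildingSet B) {σ : Finset (NestedVertex n)}
    (hσ : IsExtendedNested B σ) {τ : Finset (Finset (Fin n))} (hτ : ∀ J ∈ τ, Sum.inl J ∈ σ)
    {I : Finset (Fin n)} (hI : I ∈ B) (hcov : I ⊆ τ.biUnion id) : ∃ J ∈ τ, I ⊆ J := by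
  set μ := τ.filter fun J => (I ∩ J).Nonempty
  -- The maximal members meeting `I` are pairwise disjoint and cover `I`. Their union absorbs `I`
  -- and so lies in `B`, which nestedness forbids for two or more of them.
  set T := μ.filter fun J => ∀ K ∈ μ, J ⊆ K → J = K
  have hTτ : ∀ J ∈ T, J ∈ τ := fun J hJ =>
    (Finset.mem_filter.1 (Finset.mem_filter.1 hJ).1).1
  have hTI : ∀ J ∈ T, (I ∩ J).Nonempty := fun J hJ =>
    (Finset.mem_filter.1 (Finset.mem_filter.1 hJ).1).2
  have hTmax : ∀ J ∈ T, ∀ K ∈ T, J ⊆ K → J = K := fun J hJ K hK hJK =>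
    (Finset.mem_filter.1 hJ).2 K (Finset.mem_filter.1 hK).1 hJK
  have hcovT : ∀ i ∈ I, ∃ J ∈ T, i ∈ J := by
    intro i hi
    obtain ⟨J, hJ, hiJ⟩ := Finset.mem_biUnion.1 (hcov hi)
    have hJμ : J ∈ μ := Finset.mem_filter.2 ⟨hJ, ⟨i, Finset.mem_inter.2 ⟨hi, hiJ⟩⟩⟩
    obtain ⟨K, hJK, hK⟩ := μ.exists_le_maximal hJμ
    refine ⟨K, Finset.mem_filter.2 ⟨hK.prop, fun L hL hKL => ?_⟩, hJK hiJ⟩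
    exact Finset.Subset.antisymm hKL (hK.le_of_ge hL hKL)
  obtain ⟨i, hi⟩ := hB.nonempty_of_mem I hI
  obtain ⟨J, hJ, -⟩ := hcovT i hi
  refine ⟨J, hTτ J hJ, fun k hk => ?_⟩
  obtain ⟨K, hK, hkK⟩ := hcovT k hk
  suffices K = J from this ▸ hkK
  by_contra hne
  refine hσ.biUnion_notMem T (fun L hL => hτ L (hTτ L hL))
    (Finset.one_lt_card.2 ⟨K, hK, J, hJ, hne⟩) (fun L hL M hM hLM => ?_) ?_
  · rcases hσ.nested_or_disjoint L M (hτ L (hTτ L hL)) (hτ M (hTτ M hM)) with h | h | h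
    · exact absurd (hTmax L hL M hM h) hLM
    · exact absurd (hTmax M hM L hL h).symm hLM
    · exact h
  · have := hB.union_biUnion_mem hI T fun L hL => ⟨hσ.mem L (hτ L (hTτ L hL)), hTI L hL⟩
    have hIT : I ⊆ T.biUnion id := fun i hi => Finset.mem_biUnion.2 (hcovT i hi)
    rwa [Finset.union_eq_right.2 hIT] at this

/-- A nonnegative vector is a positive combination of the indicators of a nested collection of
subsets of its support. -/
theorem IsBuildingSet.exists_nested_decomposition (hB : IsBuildingSet B) (A : Finset (Fin n)) :
    ∀ w : Fin n → ℝ, (∀ i ∈ A, 0 < w i) → (∀ i ∉ A, w i = 0) →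
    ∃ (s : Finset (Finset (Fin n))) (c : Finset (Fin n) → ℝ),
      IsExtendedNested B (s.disjSum ∅) ∧ (∀ I ∈ s, I ⊆ A) ∧ (∀ I ∈ s, 0 < c I) ∧
      (∀ I ∉ s, c I = 0) ∧ ∀ i, w i = ∑ I, if i ∈ I then c I else 0 := by
  induction A using Finset.strongInduction with
  | H A ih =>
  intro w hpos hzero
  rcases A.eq_empty_or_nonempty with rfl | hA
  · refine ⟨∅, 0, ⟨by simp, by simp, fun T hT hcard => ?_, by simp⟩, by simp, by simp, by simp,
      fun i => by simpa using hzero i⟩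
    obtain ⟨I, hI⟩ := Finset.card_pos.1 (by omega : 0 < T.card)
    simpa using hT I hI
  obtain ⟨a, ha, hmin⟩ := A.exists_min_image w hA
  have hm := hpos a ha
  have hAsub : A.filter (fun i => w a < w i) ⊂ A :=
    Finset.filter_ssubset.2 ⟨a, ha, lt_irrefl _⟩
  obtain ⟨s, c, hs, hsA, hc, hc0, hw⟩ := ih _ hAsub (fun i => w i - if i ∈ A then w a else 0)
    (fun i hi => by
      rw [Finset.mem_filter] at hi
      simp [hi.1, hi.2])
    (fun i hi => by
      by_cases hiA : i ∈ A
      · have := hmin i hiA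
        simp only [Finset.mem_filter, hiA, true_and, not_lt] at hi
        simp [hiA, le_antisymm hi this]
      · simp [hiA, hzero i hiA])
  replace hsA : ∀ I ∈ s, I ⊆ A := fun I hI => (hsA I hI).trans hAsub.subset
  have hsmem : ∀ {I}, I ∈ s → (Sum.inl I : NestedVertex n) ∈ s.disjSum ∅ := fun h =>
    Finset.inl_mem_disjSum.2 h
  set M := B.filter fun I => I ⊆ A ∧ ∀ J ∈ B, J ⊆ A → I ⊆ J → J ⊆ I
  have hMB : ∀ I ∈ M, I ∈ B := fun I hI => (Finset.mem_filter.1 hI).1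
  have hMA : ∀ I ∈ M, I ⊆ A := fun I hI => (Finset.mem_filter.1 hI).2.1
  have hMmax : ∀ I ∈ M, ∀ J ∈ B, J ⊆ A → I ⊆ J → J ⊆ I := fun I hI =>
    (Finset.mem_filter.1 hI).2.2
  have hMsub : ∀ I ∈ M, ∀ J ∈ B, J ⊆ A → (I ∩ J).Nonempty → J ⊆ I := fun I hI J hJ hJA hIJ =>
    Finset.subset_union_right.trans (hMmax I hI (I ∪ J) (hB.union_mem I (hMB I hI) J hJ hIJ)
      (Finset.union_subset (hMA I hI) hJA) Finset.subset_union_left)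
  have hMcov : ∀ i ∈ A, ∃ I ∈ M, i ∈ I := by
    intro i hi
    obtain ⟨K, hK, hKmax⟩ := (B.filter (· ⊆ A)).exists_le_maximal
      (Finset.mem_filter.2 ⟨hB.singleton_mem i, Finset.singleton_subset_iff.2 hi⟩)
    refine ⟨K, ?_, hK (Finset.mem_singleton_self i)⟩
    have := Finset.mem_filter.1 hKmax.prop
    exact Finset.mem_filter.2 ⟨this.1, this.2, fun J hJ hJA hKJ =>
      hKmax.le_of_ge (Finset.mem_filter.2 ⟨hJ, hJA⟩) hKJ⟩
  have hsM : ∀ I ∈ M ∪ s, I ∈ B ∧ I ⊆ A := fun I hI => by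
    rcases Finset.mem_union.1 hI with h | h
    · exact ⟨hMB I h, hMA I h⟩
    · exact ⟨hs.mem I (hsmem h), hsA I h⟩
  have hdisj : ∀ I ∈ M, ∀ J ∈ M ∪ s, J ⊆ I ∨ Disjoint I J := fun I hI J hJ => by
    by_cases h : (I ∩ J).Nonempty
    · exact Or.inl (hMsub I hI J (hsM J hJ).1 (hsM J hJ).2 h)
    · exact Or.inr (Finset.disjoint_iff_inter_eq_empty.2 (Finset.not_nonempty_iff_eq_empty.1 h))
  -- A set may lie in both `M` and `s`; since `c` vanishes off `s`, the two coefficients simply add.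
  refine ⟨M ∪ s, fun I => c I + if I ∈ M then w a else 0, ⟨fun I hI => ?_, fun I J hI hJ => ?_,
    fun T hT hcard hTd hTB => ?_, by simp⟩, fun I hI => (hsM I hI).2, fun I hI => ?_,
    fun I hI => ?_, fun i => ?_⟩
  · exact (hsM I (Finset.inl_mem_disjSum.1 hI)).1
  · replace hI := Finset.inl_mem_disjSum.1 hI
    replace hJ := Finset.inl_mem_disjSum.1 hJ
    rcases Finset.mem_union.1 hI with hIM | hIs
    · rcases hdisj I hIM J hJ with h | h
      · exact Or.inr (Or.inl h)
      · exact Or.inr (Or.inr h)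
    rcases Finset.mem_union.1 hJ with hJM | hJs
    · rcases hdisj J hJM I hI with h | h
      · exact Or.inl h
      · exact Or.inr (Or.inr h.symm)
    exact hs.nested_or_disjoint I J (hsmem hIs) (hsmem hJs)
  · have hT' : ∀ I ∈ T, I ∈ M ∪ s := fun I hI => Finset.inl_mem_disjSum.1 (hT I hI)
    by_cases hTs : ∀ I ∈ T, I ∈ s
    · exact hs.biUnion_notMem T (fun I hI => hsmem (hTs I hI)) hcard hTd hTB
    push Not at hTs
    obtain ⟨I, hIT, hIs⟩ := hTs
    have hIM := (Finset.mem_union.1 (hT' I hIT)).resolve_right hIs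
    obtain ⟨J, hJT, hJI⟩ := Finset.exists_mem_ne hcard I
    -- A union in `B` that contains the maximal `I` equals `I`, so it swallows the disjoint nonempty
    -- `J`.
    have hJsub : J ⊆ I := (Finset.subset_biUnion_of_mem id hJT).trans
      (hMmax I hIM _ hTB (Finset.biUnion_subset.2 fun K hK => (hsM K (hT' K hK)).2)
        (Finset.subset_biUnion_of_mem id hIT))
    obtain ⟨j, hj⟩ := hB.nonempty_of_mem J (hsM J (hT' J hJT)).1
    exact Finset.disjoint_left.1 (hTd J hJT I hIT hJI) hj (hJsub hj)
  · by_cases hIs : I ∈ s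
    · have := hc I hIs
      dsimp only
      split_ifs <;> linarith
    · have := (Finset.mem_union.1 hI).resolve_right hIs
      simp [hc0 I hIs, this, hm]
  · rw [Finset.mem_union, not_or] at hI
    simp [hc0 I hI.2, hI.1]
  · have hsplit : ∀ I : Finset (Fin n), (if i ∈ I then c I + (if I ∈ M then w a else 0) else 0) =
        (if i ∈ I then c I else 0) + if i ∈ I ∧ I ∈ M then w a else 0 := fun I => by
      by_cases h : i ∈ I <;> simp [h]
    simp_rw [hsplit]
    rw [Finset.sum_add_distrib, ← hw i]
    suffices (∑ I : Finset (Fin n), if i ∈ I ∧ I ∈ M then w a else 0) =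
      if i ∈ A then w a else 0 by rw [this, sub_add_cancel]
    by_cases hiA : i ∈ A
    · obtain ⟨I, hIM, hiI⟩ := hMcov i hiA
      rw [Finset.sum_eq_single_of_mem I (Finset.mem_univ I)]
      · simp [hiI, hIM, hiA]
      · rintro J - hJI
        refine if_neg fun hJ => hJI (Finset.Subset.antisymm ?_ ?_)
        · exact hMsub I hIM J (hMB J hJ.2) (hMA J hJ.2) ⟨i, Finset.mem_inter.2 ⟨hiI, hJ.1⟩⟩
        · exact hMsub J hJ.2 I (hMB I hIM) (hMA I hIM) ⟨i, Finset.mem_inter.2 ⟨hJ.1, hiI⟩⟩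
    · rw [if_neg hiA]
      exact Finset.sum_eq_zero fun I _ => if_neg fun h => hiA (hMA I h.2 h.1)

/-! ### The cones of extended nested collections cover the space. -/

/-- The outer normal vectors: `e_I` for `I`, and `-e_i` for the design vertex `x_i`. -/
def outerNormal (v : NestedVertex n) : Fin n → ℝ :=
  Sum.elim basisSum (fun i => -Pi.single i 1) v

theorem outerNormal_inr_dotProduct (i : Fin n) (x : Fin n → ℝ) :
    outerNormal (Sum.inr i) ⬝ᵥ x = -x i := by
  simp [outerNormal]

theorem outerNormal_inl_dotProduct (I : Finset (Fin n)) (x : Fin n → ℝ) :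
    outerNormal (Sum.inl I) ⬝ᵥ x = ∑ i ∈ I, x i :=
  basisSum_dotProduct I x

theorem outerNormal_inl_dotProduct_basisSum (I S : Finset (Fin n)) :
    outerNormal (Sum.inl I) ⬝ᵥ basisSum S = ((I ∩ S).card : ℝ) :=
  basisSum_dotProduct_basisSum I S

/-- The positive part of `w` is decomposed by nested sets, the negative part by design vertices;
their supports are disjoint, which is the compatibility of `x_i` with `I`. -/
theorem IsBuildingSet.exists_eq_sum_outerNormal (hB : IsBuildingSet B) (w : Fin n → ℝ) :
    ∃ σ ∈ extendedNestedComplex B, ∃ c : NestedVertex n → ℝ, (∀ v ∈ σ, 0 < c v) ∧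
      w = ∑ v ∈ σ, c v • outerNormal v := by
  obtain ⟨s, c, hs, hsA, hc, hc0, hw⟩ :=
    hB.exists_nested_decomposition (Finset.univ.filter fun i => 0 < w i) (fun i => max (w i) 0)
      (fun i hi => lt_max_of_lt_left (Finset.mem_filter.1 hi).2)
      (fun i hi => max_eq_right (by simpa using hi))
  refine ⟨s.disjSum (Finset.univ.filter fun i => w i < 0), ⟨fun I hI => hs.mem I ?_,
    fun I J hI hJ => hs.nested_or_disjoint I J ?_ ?_, fun T hT => hs.biUnion_notMem T fun I hI => ?_,
    fun i I hi hI hiI => ?_⟩, Sum.elim c fun i => -w i, ?_, ?_⟩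
  · simpa using hI
  · simpa using hI
  · simpa using hJ
  · simpa using hT I hI
  · have h1 := hsA I (Finset.inl_mem_disjSum.1 hI) hiI
    have h2 := Finset.inr_mem_disjSum.1 hi
    simp only [Finset.mem_filter, Finset.mem_univ, true_and] at h1 h2
    exact lt_asymm h1 h2
  · rintro (I | i) hv
    · exact hc I (Finset.inl_mem_disjSum.1 hv)
    · simpa using hv
  · ext i
    rw [Finset.sum_disjSum]
    have h1 : (∑ I ∈ s, c I • basisSum I) i = max (w i) 0 := by
      rw [hw i, Finset.sum_apply]
      rw [← Finset.sum_subset (Finset.subset_univ s) fun I _ hI => by simp [hc0 I hI]]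
      exact Finset.sum_congr rfl fun I _ => by simp [basisSum_apply]
    have h2 : (∑ j ∈ Finset.univ.filter (fun j => w j < 0),
        (-w j) • (-Pi.single j 1 : Fin n → ℝ)) i = min (w i) 0 := by
      rw [Finset.sum_apply, Finset.sum_filter, Finset.sum_eq_single_of_mem i (Finset.mem_univ i)]
      · split_ifs with h
        · simp [h.le]
        · simp [not_lt.1 h]
      · intro j _ hj
        simp [Ne.symm hj]
    have := congrArg₂ (· + ·) h1 h2
    simp only [max_add_min, add_zero] at this
    exact this.symm

/-! ### Optimal vertices of the Minkowski summands. -/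

/-- The sets `S` whose indicators `e_S` span the summands of the Minkowski sum. -/
def summandSets (B : Finset (Finset (Fin n))) (k : Fin n ⊕ B) : Finset (Finset (Fin n)) :=
  Sum.elim (fun i => Finset.powerset {i}) (fun I => I.1.ssubsets) k

theorem minkowskiPolytope_eq_sum (B : Finset (Finset (Fin n))) :
    minkowskiPolytope B = ∑ k, convexHull ℝ (basisSum '' (summandSets B k : Set _)) := by
  rw [Fintype.sum_sum_type, minkowskiPolytope]
  congr 1
  · refine Finset.sum_congr rfl fun i _ => congrArg _ ?_
    ext x
    have : (summandSets B (Sum.inl i) : Set (Finset (Fin n))) = {∅, {i}} := by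
      ext S
      exact Finset.mem_powerset.trans Finset.subset_singleton_iff |>.trans (by simp)
    simp [this, Set.image_pair, basisSum]
  · rw [← Finset.sum_coe_sort B]
    refine Finset.sum_congr rfl fun I _ => congrArg _ ?_
    ext x
    simp [summandSets, eq_comm]

theorem isPolytope_minkowskiPolytope (B : Finset (Finset (Fin n))) :
    IsPolytope (minkowskiPolytope B) := by
  rw [minkowskiPolytope_eq_sum, ← convexHull_sum]
  have hfin : (∑ k, basisSum '' (summandSets B k : Set (Finset (Fin n)))).Finite :=
    Finset.sum_induction _ Set.Finite (fun _ _ => Set.Finite.add) Set.finite_zero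
      fun k _ => (Finset.finite_toSet _).image _
  exact ⟨hfin.toFinset, by rw [hfin.coe_toFinset]⟩

theorem sum_basisSum_mem_minkowskiPolytope {g : Fin n ⊕ B → Finset (Fin n)}
    (hg : ∀ k, g k ∈ summandSets B k) : ∑ k, basisSum (g k) ∈ minkowskiPolytope B := by
  rw [minkowskiPolytope_eq_sum, Set.mem_fintype_sum]
  exact ⟨_, fun k => subset_convexHull ℝ _ ⟨g k, hg k, rfl⟩, rfl⟩

/-- The indicator of `S` maximizes the outer normals of all the elements of `σ` among the
indicators of the members of `𝒮`. -/
def IsOptimalSet (σ : Finset (NestedVertex n)) (𝒮 : Finset (Finset (Fin n)))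
    (S : Finset (Fin n)) : Prop :=
  S ∈ 𝒮 ∧ ∀ v ∈ σ, ∀ T ∈ 𝒮, outerNormal v ⬝ᵥ basisSum T ≤ outerNormal v ⬝ᵥ basisSum S

theorem sum_basisSum_mem_optimalFace {σ : Finset (NestedVertex n)}
    {g : Fin n ⊕ B → Finset (Fin n)} (hg : ∀ k, IsOptimalSet σ (summandSets B k) (g k)) :
    ∑ k, basisSum (g k) ∈ optimalFace (minkowskiPolytope B) outerNormal σ := by
  refine ⟨sum_basisSum_mem_minkowskiPolytope fun k => (hg k).1, fun v hv y hy => ?_⟩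
  rw [minkowskiPolytope_eq_sum, Set.mem_fintype_sum] at hy
  obtain ⟨f, hf, rfl⟩ := hy
  rw [dotProduct_sum, dotProduct_sum]
  refine Finset.sum_le_sum fun k _ => dotProduct_le_of_mem_convexHull ?_ (hf k)
  rintro _ ⟨T, hT, rfl⟩
  exact (hg k).2 v hv T hT

/-- A nonoptimal choice in a single summand moves the sum off the facet of `v`. -/
theorem exists_mem_optimalFace_lt {σ : Finset (NestedVertex n)}
    (hσ : ∀ k, ∃ S, IsOptimalSet σ (summandSets B k) S) (v : NestedVertex n) (k : Fin n ⊕ B)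
    {S T : Finset (Fin n)} (hS : IsOptimalSet σ (summandSets B k) S) (hT : T ∈ summandSets B k)
    (hlt : outerNormal v ⬝ᵥ basisSum S < outerNormal v ⬝ᵥ basisSum T) :
    ∃ x ∈ optimalFace (minkowskiPolytope B) outerNormal σ, ∃ y ∈ minkowskiPolytope B,
      outerNormal v ⬝ᵥ x < outerNormal v ⬝ᵥ y := by
  choose g hg using hσ
  have hgS : ∀ j, IsOptimalSet σ (summandSets B j) (Function.update g k S j) := fun j => by
    rcases eq_or_ne j k with rfl | hj
    · simpa using hS
    · simpa [hj] using hg j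
  have hgT : ∀ j, Function.update g k T j ∈ summandSets B j := fun j => by
    rcases eq_or_ne j k with rfl | hj
    · simpa using hT
    · simpa [hj] using (hg j).1
  refine ⟨_, sum_basisSum_mem_optimalFace hgS, _, sum_basisSum_mem_minkowskiPolytope hgT, ?_⟩
  rw [dotProduct_sum, dotProduct_sum]
  refine Finset.sum_lt_sum (fun j _ => ?_) ⟨k, Finset.mem_univ k, by simpa using hlt⟩
  rcases eq_or_ne j k with rfl | hj
  · simpa using hlt.le
  · simp [hj]

theorem isOptimalSet_of_card_inter_le {σ : Finset (NestedVertex n)}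
    {𝒮 : Finset (Finset (Fin n))} {S : Finset (Fin n)} (hS : S ∈ 𝒮)
    (hinl : ∀ J, Sum.inl J ∈ σ → ∀ T ∈ 𝒮, (J ∩ T).card ≤ (J ∩ S).card)
    (hinr : ∀ i, Sum.inr i ∈ σ → i ∉ S) : IsOptimalSet σ 𝒮 S := by
  refine ⟨hS, ?_⟩
  rintro (J | i) hv T hT
  · rw [outerNormal_inl_dotProduct_basisSum, outerNormal_inl_dotProduct_basisSum]
    exact_mod_cast hinl J hv T hT
  · rw [outerNormal_inr_dotProduct, outerNormal_inr_dotProduct, basisSum_apply, basisSum_apply,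
      if_neg (hinr i hv)]
    split_ifs <;> simp

theorem isOptimalSet_empty {σ : Finset (NestedVertex n)} {i : Fin n}
    (hi : ∀ J, Sum.inl J ∈ σ → i ∉ J) : IsOptimalSet σ (summandSets B (Sum.inl i)) ∅ := by
  refine isOptimalSet_of_card_inter_le (by simp [summandSets]) (fun J hJ T hT => ?_) (by simp)
  have hT : T ⊆ {i} := Finset.mem_powerset.1 hT
  rw [Finset.inter_empty, Finset.card_empty, Nat.le_zero, Finset.card_eq_zero,
    ← Finset.disjoint_iff_inter_eq_empty]
  exact (Finset.disjoint_singleton_right.2 (hi J hJ)).mono_right hT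

theorem isOptimalSet_singleton {σ : Finset (NestedVertex n)} {i : Fin n} (hi : Sum.inr i ∉ σ) :
    IsOptimalSet σ (summandSets B (Sum.inl i)) {i} := by
  refine isOptimalSet_of_card_inter_le (by simp [summandSets]) (fun J _ T hT => ?_) fun j hj hji =>
    hi (Finset.mem_singleton.1 hji ▸ hj)
  exact Finset.card_le_card (Finset.inter_subset_inter_left (Finset.mem_powerset.1 hT))

/-- A member `K ⊇ I` only sees the size of a proper subset of `I`, at most `|I| - 1`; any other
member misses `i`, so erasing `i` costs it nothing. Design vertices of `σ` avoid `J ⊇ I`. -/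
theorem isOptimalSet_erase {σ : Finset (NestedVertex n)} (hσ : IsExtendedNested B σ)
    {I : B} {J : Finset (Fin n)} (hJ : Sum.inl J ∈ σ) (hIJ : I.1 ⊆ J) {i : Fin n} (hi : i ∈ I.1)
    (hiσ : ∀ K, Sum.inl K ∈ σ → ¬ I.1 ⊆ K → i ∉ K) :
    IsOptimalSet σ (summandSets B (Sum.inr I)) (I.1.erase i) := by
  refine isOptimalSet_of_card_inter_le (Finset.mem_ssubsets.2 (Finset.erase_ssubset hi))
    (fun K hK T hT => ?_) fun j hj hjI =>
      hσ.design_notMem j J hj hJ (hIJ (Finset.mem_of_mem_erase hjI))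
  have hT : T ⊂ I.1 := Finset.mem_ssubsets.1 hT
  by_cases hIK : I.1 ⊆ K
  · rw [Finset.inter_eq_right.2 (hT.subset.trans hIK),
      Finset.inter_eq_right.2 ((Finset.erase_subset i I.1).trans hIK), Finset.card_erase_of_mem hi]
    exact Nat.le_sub_one_of_lt (Finset.card_lt_card hT)
  · refine Finset.card_le_card fun j hj => ?_
    obtain ⟨hjK, hjT⟩ := Finset.mem_inter.1 hj
    refine Finset.mem_inter.2 ⟨hjK, Finset.mem_erase.2 ⟨?_, hT.subset hjT⟩⟩
    rintro rfl
    exact hiσ K hK hIK hjK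

theorem IsExtendedNested.exists_isOptimalSet (hB : IsBuildingSet B)
    {σ : Finset (NestedVertex n)} (hσ : IsExtendedNested B σ) (k : Fin n ⊕ B) :
    ∃ S, IsOptimalSet σ (summandSets B k) S := by
  rcases k with i | I
  · by_cases hi : Sum.inr i ∈ σ
    · exact ⟨∅, isOptimalSet_empty fun J hJ => hσ.design_notMem i J hi hJ⟩
    · exact ⟨{i}, isOptimalSet_singleton hi⟩
  by_cases hI : ∃ J, Sum.inl J ∈ σ ∧ I.1 ⊆ J
  · obtain ⟨J, hJ, hIJ⟩ := hI
    obtain ⟨i, hi, hi'⟩ : ∃ i ∈ I.1, ∀ K, Sum.inl K ∈ σ → ¬ I.1 ⊆ K → i ∉ K := by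
      -- Otherwise the members not containing `I` would cover `I`, and one of them would contain it.
      by_contra! hcon
      obtain ⟨K, hK, hIK⟩ := hσ.exists_superset hB
        (τ := σ.toLeft.filter fun K => ¬ I.1 ⊆ K) (by simp +contextual) I.2 fun i hi => by
          obtain ⟨K, hK, hIK, hiK⟩ := hcon i hi
          exact Finset.mem_biUnion.2 ⟨K, by simp [hK, hIK], hiK⟩
      exact (Finset.mem_filter.1 hK).2 hIK
    exact ⟨_, isOptimalSet_erase hσ hJ hIJ hi hi'⟩
  -- With no member above `I`, the members do not cover `I`; the covered part is a proper subset,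
  -- optimal for all of them at once.
  · refine ⟨I.1 ∩ σ.toLeft.biUnion id, isOptimalSet_of_card_inter_le ?_ (fun J hJ T hT => ?_)
      fun i hi hiS => ?_⟩
    · refine Finset.mem_ssubsets.2 (Finset.inter_subset_left.ssubset_of_ne fun heq => hI ?_)
      obtain ⟨J, hJ, hIJ⟩ := hσ.exists_superset hB (τ := σ.toLeft) (by simp) I.2
        (Finset.inter_eq_left.1 heq)
      exact ⟨J, by simpa using hJ, hIJ⟩
    · have hT : T ⊂ I.1 := Finset.mem_ssubsets.1 hT
      refine Finset.card_le_card fun j hj => ?_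
      obtain ⟨hjJ, hjT⟩ := Finset.mem_inter.1 hj
      exact Finset.mem_inter.2 ⟨hjJ, Finset.mem_inter.2 ⟨hT.subset hjT,
        Finset.mem_biUnion.2 ⟨J, by simpa using hJ, hjJ⟩⟩⟩
    · obtain ⟨J, hJ, hiJ⟩ := Finset.mem_biUnion.1 (Finset.mem_inter.1 hiS).2
      exact hσ.design_notMem i J hi (by simpa using hJ) hiJ

/-- One summand witnesses the strict inequality. For `x_i` it is the segment of `e_i`. For `I` not
covered by the members of `σ` it is the segment of an uncovered `i ∈ I`. Otherwise it is the summand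
of the smallest member `J ⊋ I`, where `J.erase i` with `i ∈ I` is optimal for `σ`, but `I` itself
does better for `e_I`. -/
theorem IsExtendedNested.exists_optimalFace_lt (hB : IsBuildingSet B)
    {σ : Finset (NestedVertex n)} (hσ : IsExtendedNested B σ) {v : NestedVertex n}
    (hv : IsExtendedNested B {v}) (hvσ : v ∉ σ) :
    ∃ x ∈ optimalFace (minkowskiPolytope B) outerNormal σ, ∃ y ∈ minkowskiPolytope B,
      outerNormal v ⬝ᵥ x < outerNormal v ⬝ᵥ y := by
  have hopt := hσ.exists_isOptimalSet hB
  rcases v with I | i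
  swap
  · refine exists_mem_optimalFace_lt hopt _ (Sum.inl i) (isOptimalSet_singleton hvσ)
      (T := ∅) (by simp [summandSets]) ?_
    simp [outerNormal_inr_dotProduct, basisSum_apply]
  have hIB : I ∈ B := hv.mem I (Finset.mem_singleton_self _)
  by_cases hcov : I ⊆ σ.toLeft.biUnion id
  swap
  · obtain ⟨i, hiI, hi⟩ := Finset.not_subset.1 hcov
    refine exists_mem_optimalFace_lt hopt _ (Sum.inl i)
      (isOptimalSet_empty fun J hJ hiJ => hi (Finset.mem_biUnion.2 ⟨J, by simpa using hJ, hiJ⟩))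
      (T := {i}) (by simp [summandSets]) ?_
    simp [outerNormal_inl_dotProduct_basisSum, hiI]
  obtain ⟨J, hJ, hIJ⟩ := hσ.exists_superset hB (τ := σ.toLeft) (by simp) hIB hcov
  obtain ⟨J, hJmin⟩ := (σ.toLeft.filter (I ⊆ ·)).exists_minimal
    ⟨J, Finset.mem_filter.2 ⟨hJ, hIJ⟩⟩
  obtain ⟨hJ, hIJ⟩ := Finset.mem_filter.1 hJmin.prop
  rw [Finset.mem_toLeft] at hJ
  have hJB := hσ.mem J hJ
  have hIJne : I ≠ J := by
    rintro rfl
    exact hvσ hJ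
  obtain ⟨i, hi, hi'⟩ : ∃ i ∈ I, ∀ K, Sum.inl K ∈ σ → ¬ J ⊆ K → i ∉ K := by
    by_contra! hcon
    obtain ⟨K, hK, hIK⟩ := hσ.exists_superset hB
      (τ := σ.toLeft.filter fun K => ¬ J ⊆ K) (by simp +contextual) hIB fun i hi => by
        obtain ⟨K, hK, hJK, hiK⟩ := hcon i hi
        exact Finset.mem_biUnion.2 ⟨K, by simp [hK, hJK], hiK⟩
    obtain ⟨hK, hJK⟩ := Finset.mem_filter.1 hK
    -- `K` contains `I` but not `J`, so it is neither above `J` nor disjoint from it, and below `J`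
    -- it would contradict minimality.
    rcases hσ.nested_or_disjoint J K hJ (by simpa using hK) with h | h | h
    · exact hJK h
    · exact hJK (hJmin.le_of_le (Finset.mem_filter.2 ⟨hK, hIK⟩) h)
    · obtain ⟨j, hj⟩ := hB.nonempty_of_mem I hIB
      exact Finset.disjoint_left.1 h (hIJ hj) (hIK hj)
  refine exists_mem_optimalFace_lt hopt _ (Sum.inr ⟨J, hJB⟩)
    (isOptimalSet_erase hσ (I := ⟨J, hJB⟩) hJ subset_rfl (hIJ hi) hi')
    (T := I) (Finset.mem_ssubsets.2 (hIJ.ssubset_of_ne hIJne)) ?_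
  rw [outerNormal_inl_dotProduct_basisSum, outerNormal_inl_dotProduct_basisSum, Finset.inter_self,
    Nat.cast_lt]
  refine Finset.card_lt_card (Finset.inter_subset_left.ssubset_of_ne fun heq => ?_)
  exact Finset.notMem_erase i J (Finset.inter_eq_left.1 heq hi)

theorem IsBuildingSet.isSimplicialNormalFan (hB : IsBuildingSet B) :
    IsSimplicialNormalFan (extendedNestedComplex B) outerNormal (minkowskiPolytope B) where
  isLowerSet := isLowerSet_extendedNestedComplex B
  exists_eq_sum := hB.exists_eq_sum_outerNormal
  nonempty σ hσ := by
    choose g hg using IsExtendedNested.exists_isOptimalSet hB hσ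
    exact ⟨_, sum_basisSum_mem_optimalFace hg⟩
  exists_lt σ hσ _ hv hvσ := IsExtendedNested.exists_optimalFace_lt hB hσ hv hvσ

theorem labelledFace_eq_optimalFace (P : Set (Fin n → ℝ)) :
    labelledFace P = optimalFace P outerNormal := by
  ext σ x
  refine and_congr_right fun _ => ⟨?_, fun h => ⟨fun I hI y hy => ?_, fun i hi y hy => ?_⟩⟩
  · rintro ⟨hl, hr⟩ (I | i) hv y hy
    · rw [outerNormal_inl_dotProduct, outerNormal_inl_dotProduct]
      exact hl I hv y hy
    · rw [outerNormal_inr_dotProduct, outerNormal_inr_dotProduct, neg_le_neg_iff]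
      exact hr i hv y hy
  · rw [← outerNormal_inl_dotProduct, ← outerNormal_inl_dotProduct]
    exact h _ hI y hy
  · rw [← neg_le_neg_iff, ← outerNormal_inr_dotProduct, ← outerNormal_inr_dotProduct]
    exact h _ hi y hy

end Combinatorics

theorem theorem3p4 (n : ℕ) (B : Finset (Finset (Fin n))) (hB : IsBuildingSet B) :
    IsExtendedNestohedron B (minkowskiPolytope B) ∧
    Set.BijOn (labelledFace (minkowskiPolytope B)) (extendedNestedComplex B)
      {F | IsExposed ℝ (minkowskiPolytope B) F ∧ F.Nonempty} ∧
    ∀ σ ∈ extendedNestedComplex B, ∀ τ ∈ extendedNestedComplex B,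
      (σ ⊆ τ ↔ labelledFace (minkowskiPolytope B) τ ⊆ labelledFace (minkowskiPolytope B) σ) := by
  have h := hB.isSimplicialNormalFan
  rw [labelledFace_eq_optimalFace]
  exact ⟨h.isExtendedNestohedron (isPolytope_minkowskiPolytope B), h.bijOn_optimalFace,
    fun σ hσ τ hτ => h.subset_iff hσ hτ⟩
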